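/- **Setting.** Let $G$ be an undirected graph on the agents $[N]$, $\mathcal N_i=\{i\}\cup\{j:(i,j)\in E\}$, $N_i=|\mathcal N_i|$. Let $\mathcal X$ be the closed Euclidean unit ball of $\mathbb R^d$ and $\mathcal U=\{U\in\mathbb R^{N\times d}: U_{i:}\in\mathcal X\ \forall i\}$. In round $t=1,2,\dots$ agent $i_t$ (an arbitrary sequence) predicts $x_t\in\mathcal X$, pays $\ell_t(x_t)$ for a convex $\ell_t:\mathcal X\to\mathbb R$ and observes some $g_t\in\partial\ell_t(x_t)$ with $\|g_t\|_2\le1$. The regret is $R_T(U)=\sum_{t\le T}\big(\ell_t(x_t)-\ell_t(U_{i_t:})\big)$. The local variances are $\sigma_j^2=\frac1{2N_j(N_j-1)}\sum_{i,i'\in\mathcal N_j}\|U_{i:}-U_{i':}\|_2^2$ (with $\sigma_j^2=0$ if $N_j=1$), and $\sigma_{\max}^2=\max_j\sigma_j^2$. **Base algorithm MT-FTRL** on $n$ agents, with parameters $\beta_0,\beta_1,\dots$, on linear losses. Let $A=(1+n)I_n-\mathbf 1\mathbf 1^\top$, $\|X\|_A^2=\operatorname{tr}(X^\top AX)$, $\Xi=\{\frac1n,\frac2n,\dots,1\}$,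 and $\sigma^2(X)=\frac1{n-1}\sum_i\|X_{i:}-\frac1n\sum_jX_{j:}\|_2^2$ ($0$ if $n=1$). In its $t$-th round, where $(i_s,g_s)_{s<t}$ are the active agents and gradients of its own earlier rounds, each expert $\xi\in\Xi$ computes $$X_t^{(\xi)}=\arg\min_X\ \frac{n\sqrt{1+\xi(n-1)}}{\beta_{t-1}}\sum_{s<t}\langle g_s,X_{i_s:}\rangle+\tfrac12\|X\|_A^2$$ over the $n\times d$ matrices $X$ with all rows in $\mathcal X$ and $\sigma^2(X)\le\xi$. The prediction is $X_t=\sum_\xi p_t^{(\xi)}X_t^{(\xi)}$ with $p_t^{(\xi)}\propto\exp\big(-\frac{\sqrt{\ln n}}{\beta_{t-1}}\sum_{s<t}\langle g_s,[X_s^{(\xi)}]_{i_s:}\rangle\big)$. Two variants are considered: *constrained*, exactly as above, and *unconstrained*, where the constraint $\sigma^2(X)\le\xi$ is dropped for the single expert $\xi=1$. **Network algorithm MT-CO$_2$OL** with uniform weights $w_{ij}=\mathbb I\{j\in\mathcal N_i\}/N_i$. Each agent $j$ runs an instance of MT-FTRL on $\mathcal N_j$ ($n=N_j$) with $\beta_{t-1}=\max_{i\in\mathcal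 N_j}w_{ij}\sqrt{1+\sum_{s\le t-1}\mathbb I\{i_s\in\mathcal N_j\}}$, fed in each round $t$ with $i_t\in\mathcal N_j$ by $(i_t,w_{i_tj}\,g_t)$; let $Y_t^{(j)}$ be its current prediction. Agent $i_t$ predicts $x_t=\sum_{j\in\mathcal N_{i_t}}w_{i_tj}[Y_t^{(j)}]_{i_t:}$. **Claim.** There are absolute constants $C,p$ such that for all $N,d,T,G$, all activations, losses and subgradients as above, and all comparators $U\in\mathcal U$ — every $U\in\mathcal U$ for the unconstrained variant, and every $U\in\mathcal U$ with $\sigma_{\max}^2\le1$ for the constrained variant — the following hold. 1. If $G$ is $K$-regular, then $$R_T(U)\le C(1+\ln N)^p\,\sqrt{1+K\sigma_{\max}^2}\,\sqrt{\frac{NT}{K+1}}.$$ 2. If $G$ is a disjoint union of $\chi$ (nonempty) cliques, then $$R_T(U)\le C(1+\ln N)^p\,\sqrt{\chi+\sigma_{\max}^2(N-\chi)}\,\sqrt T.$$ -/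

import Mathlib

open scoped InnerProductSpace

noncomputable section

namespace MTCool

/-- The ambient space `ℝ^d` with its Euclidean norm. -/
abbrev Vec (d : ℕ) := EuclideanSpace ℝ (Fin d)

/-- The decision space: the closed unit Euclidean ball of `ℝ^d`. -/
abbrev decisionSet (d : ℕ) : Set (Vec d) := Metric.closedBall 0 1

/-- `g ∈ ∂f(x)` for a function `f` on the decision space. -/
def IsSubgradient {d : ℕ} (f : Vec d → ℝ) (x g : Vec d) : Prop :=
  ∀ y ∈ decisionSet d, f x + ⟪g, y - x⟫_ℝ ≤ f y

/-! ### The clique algorithm MT-FTRL on linear losses -/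

section Clique

variable {ι : Type} [Fintype ι] [DecidableEq ι] {d : ℕ}

/-- The comparator variance `σ²(X) = 1/(N-1) ∑ᵢ ‖Xᵢ - (1/N) ∑ⱼ Xⱼ‖²`, where `N = |ι|`
(equal to `0` when `N = 1`). -/
def cliqueVar (X : ι → Vec d) : ℝ :=
  1 / ((Fintype.card ι : ℝ) - 1) *
    ∑ i, ‖X i - (1 / (Fintype.card ι : ℝ)) • ∑ j, X j‖ ^ 2

variable (ι) in
/-- The interaction matrix `A = (1 + N) I - 𝟏 𝟏ᵀ`. -/
def interaction : Matrix ι ι ℝ :=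
  (1 + (Fintype.card ι : ℝ)) • (1 : Matrix ι ι ℝ) - Matrix.of fun _ _ => 1

/-- The squared Mahalanobis norm `‖X‖²_A = tr(Xᵀ A X)`. -/
def mahalanobisSq (X : ι → Vec d) : ℝ :=
  ∑ i, ∑ j, interaction ι i j * ⟪X i, X j⟫_ℝ

/-- How the last expert `ξ = 1` is treated: either it keeps the variance constraint `σ²(X) ≤ 1`,
or that constraint is dropped, so that it optimizes over the whole multitask decision space. -/
inductive TopExpert where
  | constrained
  | unconstrained

variable (ι) in
/-- The variance level `ξ ∈ {1/N, 2/N, …, 1}` of the `k`-th expert. -/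
def level (k : Fin (Fintype.card ι)) : ℝ := ((k : ℕ) + 1) / (Fintype.card ι : ℝ)

/-- The set over which the `k`-th expert optimizes. -/
def feasible (mode : TopExpert) (k : Fin (Fintype.card ι)) : Set (ι → Vec d) :=
  {X | (∀ i, X i ∈ decisionSet d) ∧
    (cliqueVar X ≤ level ι k ∨ (mode = TopExpert.unconstrained ∧ level ι k = 1))}

/-- A minimizer of `f` over `S`. -/
def argminOn {α : Type} [Nonempty α] (f : α → ℝ) (S : Set α) : α :=
  Classical.epsilon fun x => x ∈ S ∧ IsMinOn f S x

/-- The objective minimized by the `k`-th expert after the rounds `h`: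
`η ⟨∑ₛ Gₛ, X⟩ + ½ ‖X‖²_A` with `η = (N / β) √(1 + ξ (N - 1))`.
A history `h` lists the past rounds of the instance as pairs `(iₛ, gₛ)`, the latest round first, and
`β n` is the parameter `β_n` of the algorithm after `n` rounds. -/
def expertObjective (β : ℕ → ℝ) (k : Fin (Fintype.card ι)) (h : List (ι × Vec d))
    (X : ι → Vec d) : ℝ :=
  ((Fintype.card ι : ℝ) / β h.length *
      √(1 + level ι k * ((Fintype.card ι : ℝ) - 1))) *
    (h.map fun r => ⟪r.2, X r.1⟫_ℝ).sum + 1 / 2 * mahalanobisSq X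

/-- The model of the `k`-th expert after the rounds `h`. -/
def expert (mode : TopExpert) (β : ℕ → ℝ) (k : Fin (Fintype.card ι)) (h : List (ι × Vec d)) :
    ι → Vec d :=
  argminOn (expertObjective β k h) (feasible mode k)

/-- The cumulative linear loss `∑ₛ ⟨gₛ, [Xₛ^(ξ)]_{iₛ}⟩` of the `k`-th expert. -/
def expertLoss (mode : TopExpert) (β : ℕ → ℝ) (k : Fin (Fintype.card ι)) :
    List (ι × Vec d) → ℝ
  | [] => 0
  | r :: h => expertLoss mode β k h + ⟪r.2, expert mode β k h r.1⟫_ℝ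

/-- The unnormalized Hedge weight of the `k`-th expert. -/
def hedgeWeight (mode : TopExpert) (β : ℕ → ℝ) (k : Fin (Fintype.card ι))
    (h : List (ι × Vec d)) : ℝ :=
  Real.exp (-(√(Real.log (Fintype.card ι)) / β h.length) * expertLoss mode β k h)

/-- The matrix predicted by MT-FTRL after the rounds `h`: the average of the experts' models under
the normalized Hedge weights (which are uniform before the first round). -/
def mtftrl (mode : TopExpert) (β : ℕ → ℝ) (h : List (ι × Vec d)) : ι → Vec d :=
  ∑ k, (hedgeWeight mode β k h / ∑ m, hedgeWeight mode β m h) • expert mode β k h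

end Clique

/-! ### The network algorithm MT-CO2OL -/

section Network

variable {V : Type} [Fintype V] {d : ℕ}

open Classical in
/-- The closed neighborhood `𝒩ᵢ` of agent `i`. -/
def nbhd (G : SimpleGraph V) (i : V) : Finset V :=
  Finset.univ.filter fun j => j = i ∨ G.Adj i j

theorem mem_nbhd_symm {G : SimpleGraph V} {i j : V} (h : j ∈ nbhd G i) : i ∈ nbhd G j := by
  simp only [nbhd, Finset.mem_filter, Finset.mem_univ, true_and] at h ⊢
  exact h.imp Eq.symm fun e => e.symm

/-- The local task variance `σ²_j = 1/(2 N_j (N_j - 1)) ∑_{i, i' ∈ 𝒩_j} ‖Uᵢ - Uᵢ'‖²`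
(equal to `0` when `N_j = 1`). -/
def localVar (G : SimpleGraph V) (U : V → Vec d) (j : V) : ℝ :=
  1 / (2 * ((nbhd G j).card : ℝ) * (((nbhd G j).card : ℝ) - 1)) *
    ∑ i ∈ nbhd G j, ∑ i' ∈ nbhd G j, ‖U i - U i'‖ ^ 2

/-- `σ²_max = max_j σ²_j`. -/
def maxLocalVar (G : SimpleGraph V) (U : V → Vec d) : ℝ := ⨆ j, localVar G U j

open Classical in
/-- The uniform weights `w_{ij} = 𝕀{j ∈ 𝒩ᵢ} / Nᵢ`. -/
def uniformWeight (G : SimpleGraph V) (i j : V) : ℝ :=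
  if j ∈ nbhd G i then 1 / ((nbhd G i).card : ℝ) else 0

open Classical in
/-- The rounds among the first `t` ones (rounds are numbered from `0`) in which agent `j` receives
feedback, i.e. those with `iₛ ∈ 𝒩_j`, with the weighted gradients `w_{iₛ j} gₛ`; latest first. -/
def localHistory (G : SimpleGraph V) (w : V → V → ℝ) (act : ℕ → V) (g : ℕ → Vec d) (j : V) :
    ℕ → List (nbhd G j × Vec d)
  | 0 => []
  | t + 1 =>
    if h : act t ∈ nbhd G j then
      (⟨act t, h⟩, w (act t) j • g t) :: localHistory G w act g j t
    else localHistory G w act g j t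

/-- The prediction `x_t = ∑_{j ∈ 𝒩_{i_t}} w_{i_t j} [Y_t^(j)]_{i_t}` of the meta-algorithm in which
agent `j` runs the clique algorithm `base j` on its closed neighborhood. -/
def coolPrediction (G : SimpleGraph V) (w : V → V → ℝ)
    (base : (j : V) → List (nbhd G j × Vec d) → (nbhd G j → Vec d))
    (act : ℕ → V) (g : ℕ → Vec d) (t : ℕ) : Vec d :=
  ∑ j : nbhd G (act t), w (act t) j •
    base j (localHistory G w act g j t) ⟨act t, mem_nbhd_symm j.2⟩

/-- The parameter `β_n = max_{i ∈ 𝒩_j} w_{ij} √(1 + n)` of agent `j` after `n` local rounds. -/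
def localBeta (G : SimpleGraph V) (w : V → V → ℝ) (j : V) (n : ℕ) : ℝ :=
  (⨆ i : nbhd G j, w i j) * √(1 + n)

open Classical in
/-- The predictions of MT-CO2OL: the meta-algorithm with base algorithm MT-FTRL. -/
def mtcool (mode : TopExpert) (G : SimpleGraph V) (w : V → V → ℝ)
    (act : ℕ → V) (g : ℕ → Vec d) : ℕ → Vec d :=
  coolPrediction G w (fun j => mtftrl mode (localBeta G w j)) act g

/-- The multitask regret `R_T(U) = ∑_{t < T} (ℓ_t(x_t) - ℓ_t(U_{i_t}))`. -/
def regret (ℓ : ℕ → Vec d → ℝ) (act : ℕ → V) (x : ℕ → Vec d) (T : ℕ) (U : V → Vec d) : ℝ :=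
  ∑ t ∈ Finset.range T, (ℓ t (x t) - ℓ t (U (act t)))

/-- `G` is a disjoint union of `χ` (nonempty) cliques. -/
def IsUnionOfCliques (G : SimpleGraph V) (χ : ℕ) : Prop :=
  ∃ c : V → Fin χ, Function.Surjective c ∧ ∀ i j, G.Adj i j ↔ i ≠ j ∧ c i = c j

end Network

end MTCool

end

/-! Convexity replaces the losses by the gradients $g_t$. The uniform weights sum to one over each
neighborhood, so the linearized network regret is exactly the sum over $j$ of the regrets of the
local MT-FTRL instances (`sum_inner_mtcool_eq`).

On $n$ agents with gradients of norm at most $W$, expert $\xi$ is FTRL in the norm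
$\|X\|_A^2=\sum_i\|X_i\|^2+n\sum_i\|X_i-\bar X\|^2$. This is at most $2n(1+\xi(n-1))$ on its
feasible set, while $n\|X_i\|^2\le2\|X\|_A^2$ bounds the effect of a gradient touching one row;
balancing the two gives regret of order $W\sqrt{1+\xi(n-1)}\sqrt\tau$ over $\tau$ rounds
(`expertLoss_le`). Some level $\xi$ matches the comparator variance up to a factor 2
(`exists_mem_feasible`), and Hedge finds it at the cost of a term $W\sqrt{\ln n}\sqrt\tau$
(`mtftrlLoss_le`).

In both graph classes neighbors have equally large neighborhoods, so $W=1/N_j$ and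
$\sum_j\tau_j/N_j=T$. Cauchy–Schwarz over $j$ leaves $\sum_j(1+(N_j-1)\sigma_{\max}^2)/N_j$
(`regret_mtcool_le`), which is explicit for regular graphs and for unions of cliques. -/

noncomputable section

namespace MTCool

/-! ### Linear losses along a history. -/

section LinearLoss

variable {ι : Type} {d : ℕ}

/-- The linear loss of a fixed matrix on a history. -/
def linearLoss (h : List (ι × Vec d)) (X : ι → Vec d) : ℝ := (h.map fun r => ⟪r.2, X r.1⟫_ℝ).sum

theorem linearLoss_cons (r : ι × Vec d) (h : List (ι × Vec d)) (X : ι → Vec d) :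
    linearLoss (r :: h) X = ⟪r.2, X r.1⟫_ℝ + linearLoss h X := by
  simp [linearLoss]

theorem continuous_linearLoss (h : List (ι × Vec d)) : Continuous (linearLoss h) := by
  induction h with
  | nil => exact continuous_const
  | cons r h ih =>
    simp only [funext fun X => linearLoss_cons r h X]
    fun_prop

theorem linearLoss_half_add (h : List (ι × Vec d)) (X Y : ι → Vec d) :
    linearLoss h ((1 / 2 : ℝ) • (X + Y)) = 1 / 2 * linearLoss h X + 1 / 2 * linearLoss h Y := by
  induction h with
  | nil => simp [linearLoss]
  | cons r h ih =>
    simp only [linearLoss_cons, ih, Pi.smul_apply, Pi.add_apply, inner_smul_right, inner_add_right]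
    ring

end LinearLoss

/-! ### Geometry of the interaction norm and the regret of a single FTRL expert. -/

section Clique

variable {ι : Type} [Fintype ι] {d : ℕ}

/-- The parallelogram law. Applied row by row, it yields the midpoint identities for `mahalanobisSq`
and `cliqueVar`, the only form of convexity used for the experts. -/
theorem norm_half_add_sq {E : Type*} [NormedAddCommGroup E] [InnerProductSpace ℝ E] (a b : E) :
    ‖(1 / 2 : ℝ) • (a + b)‖ ^ 2 = 1 / 2 * ‖a‖ ^ 2 + 1 / 2 * ‖b‖ ^ 2 - 1 / 4 * ‖a - b‖ ^ 2 := by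
  rw [norm_smul, mul_pow, norm_add_sq_real, norm_sub_sq_real]
  norm_num
  ring

theorem card_pos_real [Nonempty ι] : (1 : ℝ) ≤ Fintype.card ι := by
  exact_mod_cast Fintype.card_pos (α := ι)

/-- The sum of the squared distances to the mean, in expanded form. -/
theorem sum_norm_sub_mean_sq [Nonempty ι] (X : ι → Vec d) :
    ∑ i, ‖X i - (1 / (Fintype.card ι : ℝ)) • ∑ j, X j‖ ^ 2 =
      ∑ i, ‖X i‖ ^ 2 - 1 / (Fintype.card ι : ℝ) * ‖∑ j, X j‖ ^ 2 := by
  have hn : (Fintype.card ι : ℝ) ≠ 0 := by linarith [card_pos_real (ι := ι)]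
  have h : ∀ i, ‖X i - (1 / (Fintype.card ι : ℝ)) • ∑ j, X j‖ ^ 2 =
      ‖X i‖ ^ 2 - 2 / (Fintype.card ι : ℝ) * ⟪X i, ∑ j, X j⟫_ℝ +
        (1 / (Fintype.card ι : ℝ)) ^ 2 * ‖∑ j, X j‖ ^ 2 := by
    intro i
    rw [norm_sub_sq_real, inner_smul_right, norm_smul, mul_pow, Real.norm_eq_abs, sq_abs]
    ring
  simp only [h]
  rw [Finset.sum_add_distrib, Finset.sum_sub_distrib, ← Finset.mul_sum, ← sum_inner,
    real_inner_self_eq_norm_sq, Finset.sum_const, Finset.card_univ, nsmul_eq_mul]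
  field_simp
  ring

theorem mahalanobisSq_expand [DecidableEq ι] (X : ι → Vec d) :
    mahalanobisSq X = (1 + (Fintype.card ι : ℝ)) * ∑ i, ‖X i‖ ^ 2 - ‖∑ j, X j‖ ^ 2 := by
  have h : ∀ i, ∑ j, interaction ι i j * ⟪X i, X j⟫_ℝ =
      (1 + (Fintype.card ι : ℝ)) * ‖X i‖ ^ 2 - ⟪X i, ∑ j, X j⟫_ℝ := by
    intro i
    simp only [interaction, Matrix.sub_apply, Matrix.smul_apply, Matrix.of_apply, Matrix.one_apply,
      smul_eq_mul, sub_mul, Finset.sum_sub_distrib, one_mul, mul_ite, mul_one, mul_zero, ite_mul,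
      zero_mul, Finset.sum_ite_eq, Finset.mem_univ, if_true, real_inner_self_eq_norm_sq, inner_sum]
  rw [mahalanobisSq, Finset.sum_congr rfl fun i _ => h i, Finset.sum_sub_distrib,
    ← Finset.mul_sum, ← sum_inner, real_inner_self_eq_norm_sq]

theorem mahalanobisSq_eq [DecidableEq ι] [Nonempty ι] (X : ι → Vec d) :
    mahalanobisSq X = ∑ i, ‖X i‖ ^ 2 + (Fintype.card ι : ℝ) *
      ∑ i, ‖X i - (1 / (Fintype.card ι : ℝ)) • ∑ j, X j‖ ^ 2 := by
  have hn : (Fintype.card ι : ℝ) ≠ 0 := by linarith [card_pos_real (ι := ι)]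
  rw [mahalanobisSq_expand, sum_norm_sub_mean_sq]
  field_simp
  ring

theorem mahalanobisSq_nonneg [DecidableEq ι] [Nonempty ι] (X : ι → Vec d) :
    0 ≤ mahalanobisSq X := by
  rw [mahalanobisSq_eq]
  positivity

theorem cliqueVar_nonneg [Nonempty ι] (X : ι → Vec d) : 0 ≤ cliqueVar X := by
  have : (0 : ℝ) ≤ (Fintype.card ι : ℝ) - 1 := by linarith [card_pos_real (ι := ι)]
  unfold cliqueVar
  positivity

/-- For a single agent the division by zero in `cliqueVar` is harmless, since the only deviation
from the mean vanishes too. -/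
theorem card_sub_one_mul_cliqueVar [Nonempty ι] (X : ι → Vec d) :
    ((Fintype.card ι : ℝ) - 1) * cliqueVar X =
      ∑ i, ‖X i - (1 / (Fintype.card ι : ℝ)) • ∑ j, X j‖ ^ 2 := by
  by_cases h : (Fintype.card ι : ℝ) - 1 = 0
  · have h1 : (Fintype.card ι : ℝ) = 1 := by linarith
    rw [sum_norm_sub_mean_sq, h1, sub_self, zero_mul]
    obtain ⟨i, hi⟩ := Fintype.card_eq_one_iff.1 (by exact_mod_cast h1 : Fintype.card ι = 1)
    have : Unique ι := ⟨⟨i⟩, hi⟩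
    simp
  · rw [cliqueVar, ← mul_assoc, mul_one_div_cancel h, one_mul]

theorem mahalanobisSq_half_add [DecidableEq ι] (X Y : ι → Vec d) :
    mahalanobisSq ((1 / 2 : ℝ) • (X + Y)) =
      1 / 2 * mahalanobisSq X + 1 / 2 * mahalanobisSq Y - 1 / 4 * mahalanobisSq (X - Y) := by
  simp only [mahalanobisSq_expand, Pi.smul_apply, Pi.add_apply, Pi.sub_apply, ← Finset.smul_sum,
    Finset.sum_add_distrib, Finset.sum_sub_distrib, norm_half_add_sq, ← Finset.mul_sum]
  ring

theorem cliqueVar_half_add (X Y : ι → Vec d) :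
    cliqueVar ((1 / 2 : ℝ) • (X + Y)) =
      1 / 2 * cliqueVar X + 1 / 2 * cliqueVar Y - 1 / 4 * cliqueVar (X - Y) := by
  have h : ∀ i, ((1 / 2 : ℝ) • (X + Y)) i -
      (1 / (Fintype.card ι : ℝ)) • ∑ j, ((1 / 2 : ℝ) • (X + Y)) j =
      (1 / 2 : ℝ) • ((X i - (1 / (Fintype.card ι : ℝ)) • ∑ j, X j) +
        (Y i - (1 / (Fintype.card ι : ℝ)) • ∑ j, Y j)) := by
    intro i
    simp only [Pi.smul_apply, Pi.add_apply, ← Finset.smul_sum, Finset.sum_add_distrib]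
    module
  have h' : ∀ i, (X i - (1 / (Fintype.card ι : ℝ)) • ∑ j, X j) -
      (Y i - (1 / (Fintype.card ι : ℝ)) • ∑ j, Y j) =
      (X - Y) i - (1 / (Fintype.card ι : ℝ)) • ∑ j, (X - Y) j := by
    intro i
    simp only [Pi.sub_apply, Finset.sum_sub_distrib]
    module
  simp only [cliqueVar, h, norm_half_add_sq, h', Finset.sum_add_distrib, Finset.sum_sub_distrib,
    ← Finset.mul_sum]
  ring

/-- A single row is controlled by the Mahalanobis norm. -/
theorem card_mul_norm_sq_le_mahalanobisSq [DecidableEq ι] [Nonempty ι] (X : ι → Vec d) (i : ι) :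
    (Fintype.card ι : ℝ) * ‖X i‖ ^ 2 ≤ 2 * mahalanobisSq X := by
  have hn : (1 : ℝ) ≤ Fintype.card ι := card_pos_real
  -- The row is split into mean and deviation: the mean is paid for by $\sum_j\|X_j\|^2$, the
  -- deviation by the second term of `mahalanobisSq_eq`, which carries the weight $n$.
  set m := (1 / (Fintype.card ι : ℝ)) • ∑ j, X j with hm
  have h1 : ‖X i‖ ^ 2 ≤ 2 * ‖m‖ ^ 2 + 2 * ‖X i - m‖ ^ 2 := by
    have h := norm_le_norm_add_norm_sub' (X i) m
    nlinarith [sq_nonneg (‖m‖ - ‖X i - m‖), norm_nonneg (X i), norm_nonneg m]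
  have h2 : ‖X i - m‖ ^ 2 ≤ ∑ j, ‖X j - m‖ ^ 2 :=
    Finset.single_le_sum (f := fun j => ‖X j - m‖ ^ 2) (fun _ _ => by positivity)
      (Finset.mem_univ i)
  have h3 : (Fintype.card ι : ℝ) * ‖m‖ ^ 2 ≤ ∑ j, ‖X j‖ ^ 2 := by
    have h := sum_norm_sub_mean_sq X
    have h0 : 0 ≤ ∑ i, ‖X i - (1 / (Fintype.card ι : ℝ)) • ∑ j, X j‖ ^ 2 := by positivity
    have e : (Fintype.card ι : ℝ) * ‖m‖ ^ 2 = 1 / (Fintype.card ι : ℝ) * ‖∑ j, X j‖ ^ 2 := by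
      rw [hm, norm_smul, mul_pow, Real.norm_eq_abs, sq_abs]
      field_simp
    linarith
  rw [mahalanobisSq_eq, ← hm]
  nlinarith

theorem sum_norm_sq_le_card {X : ι → Vec d} (hX : ∀ i, X i ∈ decisionSet d) :
    ∑ i, ‖X i‖ ^ 2 ≤ Fintype.card ι := by
  calc ∑ i, ‖X i‖ ^ 2 ≤ ∑ _i : ι, (1 : ℝ) := Finset.sum_le_sum fun i _ => by
        have := mem_closedBall_zero_iff.1 (hX i)
        nlinarith [norm_nonneg (X i)]
    _ = Fintype.card ι := by simp

/-- The quantity `1 + ξ (N - 1)` attached to the `k`-th expert. -/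
def levelScale (k : Fin (Fintype.card ι)) : ℝ := 1 + level ι k * ((Fintype.card ι : ℝ) - 1)

theorem level_pos (k : Fin (Fintype.card ι)) : 0 < level ι k := by
  have : 0 < Fintype.card ι := k.pos
  unfold level
  positivity

theorem one_le_levelScale [Nonempty ι] (k : Fin (Fintype.card ι)) : 1 ≤ levelScale k := by
  have := mul_nonneg (level_pos k).le (sub_nonneg.2 (card_pos_real (ι := ι)))
  unfold levelScale
  linarith

/-- Every matrix available to the `k`-th expert has a small Mahalanobis norm. -/
theorem mahalanobisSq_le_of_mem_feasible [DecidableEq ι] [Nonempty ι] {mode : TopExpert}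
    {k : Fin (Fintype.card ι)} {X : ι → Vec d} (hX : X ∈ feasible mode k) :
    mahalanobisSq X ≤ 2 * (Fintype.card ι : ℝ) * levelScale k := by
  have hn : (1 : ℝ) ≤ Fintype.card ι := card_pos_real
  have h1 := sum_norm_sq_le_card hX.1
  have h2 := one_le_levelScale k
  rw [mahalanobisSq_eq]
  rcases hX.2 with h | ⟨-, h⟩
  · rw [← card_sub_one_mul_cliqueVar]
    have : 1 + ((Fintype.card ι : ℝ) - 1) * cliqueVar X ≤ levelScale k := by
      unfold levelScale
      nlinarith
    nlinarith
  -- Without the variance constraint, the deviations still sum to at most $\sum_i\|X_i\|^2\le n$,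
  -- and $n+n^2\le2n\cdot n$.
  · have h3 : levelScale k = Fintype.card ι := by
      rw [levelScale, h]
      ring
    rw [h3, sum_norm_sub_mean_sq]
    have : 0 ≤ 1 / (Fintype.card ι : ℝ) * ‖∑ j, X j‖ ^ 2 := by positivity
    nlinarith

theorem continuous_cliqueVar : Continuous (cliqueVar : (ι → Vec d) → ℝ) := by
  unfold cliqueVar
  fun_prop

theorem half_add_mem_feasible [Nonempty ι] {mode : TopExpert} {k : Fin (Fintype.card ι)}
    {X Y : ι → Vec d} (hX : X ∈ feasible mode k) (hY : Y ∈ feasible mode k) :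
    (1 / 2 : ℝ) • (X + Y) ∈ feasible mode k := by
  refine ⟨fun i => ?_, ?_⟩
  · have hx := mem_closedBall_zero_iff.1 (hX.1 i)
    have hy := mem_closedBall_zero_iff.1 (hY.1 i)
    have h := norm_add_le (X i) (Y i)
    rw [mem_closedBall_zero_iff, Pi.smul_apply, Pi.add_apply, norm_smul, Real.norm_eq_abs,
      abs_of_pos one_half_pos]
    linarith
  · rcases hX.2 with h | h
    · rcases hY.2 with h' | h'
      · left
        have := cliqueVar_nonneg (X - Y)
        rw [cliqueVar_half_add]
        linarith
      · exact Or.inr h'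
    · exact Or.inr h

theorem zero_mem_feasible (mode : TopExpert) (k : Fin (Fintype.card ι)) :
    (0 : ι → Vec d) ∈ feasible mode k := by
  refine ⟨fun i => by simp, Or.inl ?_⟩
  have := (level_pos k).le
  simpa [cliqueVar] using this

theorem isCompact_feasible (mode : TopExpert) (k : Fin (Fintype.card ι)) :
    IsCompact (feasible (ι := ι) (d := d) mode k) := by
  have hc : IsCompact (Set.pi Set.univ fun _ : ι => decisionSet d) :=
    isCompact_univ_pi fun _ => isCompact_closedBall 0 1
  refine hc.of_isClosed_subset ?_ fun X hX i _ => hX.1 i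
  have h1 : IsClosed {X : ι → Vec d | ∀ i, X i ∈ decisionSet d} := by
    simp only [Set.ofPred_forall]
    exact isClosed_iInter fun i => Metric.isClosed_closedBall.preimage (continuous_apply i)
  exact h1.inter ((isClosed_le continuous_cliqueVar continuous_const).union isClosed_const)

theorem argminOn_spec {α : Type} [Nonempty α] {f : α → ℝ} {S : Set α}
    (h : ∃ x ∈ S, IsMinOn f S x) : argminOn f S ∈ S ∧ IsMinOn f S (argminOn f S) :=
  Classical.epsilon_spec (p := fun x => x ∈ S ∧ IsMinOn f S x) h

/-- The learning rate `(N / β) √(1 + ξ (N - 1))` of the `k`-th expert after `n` rounds. -/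
def expertRate (β : ℕ → ℝ) (k : Fin (Fintype.card ι)) (n : ℕ) : ℝ :=
  (Fintype.card ι : ℝ) / β n * √(levelScale k)

theorem expertRate_pos [Nonempty ι] {β : ℕ → ℝ} {W : ℝ} (hW : 0 < W)
    (hβ : ∀ n, β n = W * √(1 + n)) (k : Fin (Fintype.card ι)) (n : ℕ) : 0 < expertRate β k n := by
  have h1 := one_le_levelScale k
  have h2 := card_pos_real (ι := ι)
  unfold expertRate
  rw [hβ]
  positivity

theorem expertRate_anti [Nonempty ι] {β : ℕ → ℝ} {W : ℝ} (hW : 0 < W)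
    (hβ : ∀ n, β n = W * √(1 + n)) (k : Fin (Fintype.card ι)) (n : ℕ) :
    expertRate β k (n + 1) ≤ expertRate β k n := by
  unfold expertRate
  rw [hβ, hβ]
  gcongr
  omega

variable [DecidableEq ι]

theorem expertObjective_eq (β : ℕ → ℝ) (k : Fin (Fintype.card ι)) (h : List (ι × Vec d))
    (X : ι → Vec d) :
    expertObjective β k h X =
      expertRate β k h.length * linearLoss h X + 1 / 2 * mahalanobisSq X := rfl

theorem continuous_expertObjective (β : ℕ → ℝ) (k : Fin (Fintype.card ι))
    (h : List (ι × Vec d)) : Continuous (expertObjective β k h) := by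
  have := continuous_linearLoss h
  simp only [funext fun X => expertObjective_eq β k h X, mahalanobisSq]
  fun_prop

theorem expert_spec (mode : TopExpert) (β : ℕ → ℝ) (k : Fin (Fintype.card ι))
    (h : List (ι × Vec d)) :
    expert mode β k h ∈ feasible mode k ∧
      IsMinOn (expertObjective β k h) (feasible mode k) (expert mode β k h) :=
  argminOn_spec <| (isCompact_feasible mode k).exists_isMinOn ⟨0, zero_mem_feasible mode k⟩
    (continuous_expertObjective β k h).continuousOn

/-- Quadratic growth of the objective away from its minimizer. -/
theorem expertObjective_add_le [Nonempty ι] (mode : TopExpert) (β : ℕ → ℝ)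
    (k : Fin (Fintype.card ι)) (h : List (ι × Vec d)) {X : ι → Vec d}
    (hX : X ∈ feasible mode k) :
    expertObjective β k h (expert mode β k h) + 1 / 4 * mahalanobisSq (X - expert mode β k h) ≤
      expertObjective β k h X := by
  obtain ⟨hm, hmin⟩ := expert_spec mode β k h
  -- Comparing the minimizer with its midpoint to `X` needs neither gradients nor uniqueness of the
  -- minimizer; the growth constant is 1/4 instead of the optimal 1/2.
  have h1 : expertObjective β k h (expert mode β k h) ≤ _ := hmin (half_add_mem_feasible hX hm)
  simp only [expertObjective_eq, linearLoss_half_add, mahalanobisSq_half_add] at h1 ⊢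
  linarith

/-- Turns the per-round errors of FTRL and of Hedge into telescoping differences of square roots. -/
theorem one_div_sqrt_le (m : ℕ) : 1 / √(1 + (m : ℝ)) ≤ 2 * (√(1 + (m : ℝ)) - √m) := by
  have h1 : (0 : ℝ) < √(1 + (m : ℝ)) := by positivity
  have h2 := Real.sq_sqrt (by positivity : (0 : ℝ) ≤ 1 + (m : ℝ))
  have h3 := Real.sq_sqrt (by positivity : (0 : ℝ) ≤ (m : ℝ))
  rw [div_le_iff₀ h1]
  nlinarith [sq_nonneg (√(1 + (m : ℝ)) - √m)]

/-- The minimal objective divided by the current rate serves as potential. Each round, its increase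
covers the loss up to a stability error, and these errors telescope. -/
theorem expertLoss_le_expertObjective [Nonempty ι] (mode : TopExpert) {β : ℕ → ℝ} {W : ℝ}
    (hW : 0 < W) (hβ : ∀ n, β n = W * √(1 + n)) (k : Fin (Fintype.card ι)) :
    ∀ h : List (ι × Vec d), (∀ r ∈ h, ‖r.2‖ ≤ W) →
      expertLoss mode β k h ≤ expertObjective β k h (expert mode β k h) /
        expertRate β k h.length + 4 * √(levelScale k) * W * √h.length
  | [], _ => by
    have := mahalanobisSq_nonneg (expert mode β k ([] : List (ι × Vec d)))
    have := expertRate_pos hW hβ k 0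
    simp only [expertLoss, expertObjective_eq, linearLoss, List.length_nil, List.map_nil,
      List.sum_nil, mul_zero, zero_add, Nat.cast_zero, Real.sqrt_zero, add_zero]
    positivity
  | r :: h, hh => by
    have ih := expertLoss_le_expertObjective mode hW hβ k h
      fun s hs => hh s (List.mem_cons_of_mem _ hs)
    have hn := card_pos_real (ι := ι)
    have hg : ‖r.2‖ ≤ W := hh r List.mem_cons_self
    set X := expert mode β k h
    obtain ⟨hY, -⟩ := expert_spec mode β k (r :: h)
    set Y := expert mode β k (r :: h)
    set η := expertRate β k h.length with hη
    set η' := expertRate β k (r :: h).length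
    have η0 : 0 < η := expertRate_pos hW hβ k _
    have η0' : 0 < η' := expertRate_pos hW hβ k _
    have hηη : η' ≤ η := expertRate_anti hW hβ k _
    have hgrow := expertObjective_add_le mode β k h hY
    have hrow := card_mul_norm_sq_le_mahalanobisSq (Y - X) r.1
    have hYn := mahalanobisSq_nonneg Y
    rw [Pi.sub_apply] at hrow
    have hin : ⟪r.2, X r.1⟫_ℝ ≤ ⟪r.2, Y r.1⟫_ℝ + W * ‖Y r.1 - X r.1‖ := by
      have h1 := real_inner_le_norm r.2 (X r.1 - Y r.1)
      rw [inner_sub_right, norm_sub_rev] at h1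
      nlinarith [norm_nonneg (Y r.1 - X r.1)]
    set D := ‖Y r.1 - X r.1‖
    -- The constant 1/8 is the growth constant 1/4 times the factor 1/2 from `hrow`.
    have hobj : expertObjective β k h X / η + (Fintype.card ι : ℝ) * D ^ 2 / 8 / η ≤
        expertObjective β k h Y / η := by
      rw [← add_div]
      gcongr
      linarith
    -- After division by the rate only the regularizer depends on it; the regularizer is
    -- nonnegative, so a smaller rate can only increase the quotient.
    have hreg : expertObjective β k h Y / η + ⟪r.2, Y r.1⟫_ℝ ≤
        expertObjective β k (r :: h) Y / η' := by
      rw [expertObjective_eq, expertObjective_eq, linearLoss_cons, add_div, add_div,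
        mul_div_cancel_left₀ _ η0.ne', mul_div_cancel_left₀ _ η0'.ne']
      have : 1 / 2 * mahalanobisSq Y / η ≤ 1 / 2 * mahalanobisSq Y / η' := by gcongr
      linarith
    -- The quadratic growth absorbs the displacement from `X` to `Y`; the difference of the two
    -- sides is a perfect square.
    have hyoung : W * D ≤ (Fintype.card ι : ℝ) * D ^ 2 / 8 / η +
        2 * η * W ^ 2 / (Fintype.card ι : ℝ) := by
      have : (Fintype.card ι : ℝ) * D ^ 2 / 8 / η + 2 * η * W ^ 2 / (Fintype.card ι : ℝ) - W * D =
          ((Fintype.card ι : ℝ) * D - 4 * η * W) ^ 2 / (8 * η * (Fintype.card ι : ℝ)) := by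
        field_simp
        ring
      have : 0 ≤ ((Fintype.card ι : ℝ) * D - 4 * η * W) ^ 2 / (8 * η * (Fintype.card ι : ℝ)) := by
        positivity
      linarith
    have herr : 2 * η * W ^ 2 / (Fintype.card ι : ℝ) ≤
        4 * √(levelScale k) * W * (√(r :: h).length - √h.length) := by
      have e : 2 * η * W ^ 2 / (Fintype.card ι : ℝ) =
          2 * √(levelScale k) * W * (1 / √(1 + (h.length : ℝ))) := by
        rw [hη, expertRate, hβ]
        field_simp
      have h1 := mul_le_mul_of_nonneg_left (one_div_sqrt_le h.length)
        (by positivity : 0 ≤ 2 * √(levelScale k) * W)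
      rw [e, List.length_cons, Nat.cast_succ, add_comm (h.length : ℝ)]
      linarith
    simp only [expertLoss]
    linarith

/-- The regret of the `k`-th expert. -/
theorem expertLoss_le [Nonempty ι] (mode : TopExpert) {β : ℕ → ℝ} {W : ℝ}
    (hW : 0 < W) (hβ : ∀ n, β n = W * √(1 + n)) {k : Fin (Fintype.card ι)}
    {h : List (ι × Vec d)} (hh : ∀ r ∈ h, ‖r.2‖ ≤ W) {u : ι → Vec d}
    (hu : u ∈ feasible mode k) :
    expertLoss mode β k h ≤
      linearLoss h u + 5 * √(levelScale k) * W * √(1 + h.length) := by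
  have hn := card_pos_real (ι := ι)
  have hρ := one_le_levelScale k
  have h1 := expertLoss_le_expertObjective mode hW hβ k h hh
  have η0 := expertRate_pos hW hβ k h.length
  have h2 : expertObjective β k h (expert mode β k h) ≤ expertObjective β k h u :=
    (expert_spec mode β k h).2 hu
  have h3 := div_le_div_of_nonneg_right h2 η0.le
  rw [expertObjective_eq β k h u, add_div, mul_div_cancel_left₀ _ η0.ne'] at h3
  -- The regularization penalty adds 1 to the stability constant 4, whence the 5.
  have h4 : 1 / 2 * mahalanobisSq u / expertRate β k h.length ≤
      √(levelScale k) * W * √(1 + h.length) := by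
    have h5 := mahalanobisSq_le_of_mem_feasible hu
    have h6 := Real.mul_self_sqrt (by linarith : 0 ≤ levelScale k)
    rw [div_le_iff₀ η0, expertRate, hβ]
    have e : √(levelScale k) * W * √(1 + h.length) *
        ((Fintype.card ι : ℝ) / (W * √(1 + h.length)) * √(levelScale k)) =
        (Fintype.card ι : ℝ) * (√(levelScale k) * √(levelScale k)) := by
      field_simp
    rw [e, h6]
    linarith
  have h7 : √(h.length : ℝ) ≤ √(1 + h.length) := Real.sqrt_le_sqrt (by linarith)
  have h8 := mul_le_mul_of_nonneg_left h7 (by positivity : 0 ≤ 4 * √(levelScale k) * W)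
  linarith

end Clique

/-! ### Hedge with a decreasing learning rate. -/

/-- Hoeffding's lemma for a finite distribution, with a non-optimal constant. -/
theorem sum_mul_exp_neg_le {κ : Type*} [Fintype κ] {p x : κ → ℝ} {b : ℝ} (hp : ∀ k, 0 ≤ p k)
    (hp1 : ∑ k, p k = 1) (hx : ∀ k, |x k| ≤ b) :
    ∑ k, p k * Real.exp (-x k) ≤ Real.exp (-∑ k, p k * x k + 2 * b ^ 2) := by
  have hjensen : Real.exp (∑ k, p k * x k) ≤ ∑ k, p k * Real.exp (x k) := by
    simpa only [smul_eq_mul] using convexOn_exp.map_sum_le (t := Finset.univ) (w := p) (p := x)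
      (fun k _ => hp k) hp1 fun k _ => Set.mem_univ _
  -- Symmetrization: the product is an expectation over two independent copies, and averaging over
  -- their exchange produces $\cosh(x_i-x_j)\le\exp((2b)^2/2)$.
  have hprod : (∑ k, p k * Real.exp (-x k)) * ∑ k, p k * Real.exp (x k) ≤
      Real.exp (2 * b ^ 2) := by
    have h1 : (∑ k, p k * Real.exp (-x k)) * ∑ k, p k * Real.exp (x k) =
        ∑ i, ∑ j, p i * p j * Real.exp (x j - x i) := by
      rw [Finset.sum_mul_sum]
      refine Finset.sum_congr rfl fun i _ => Finset.sum_congr rfl fun j _ => ?_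
      rw [sub_eq_neg_add, Real.exp_add]
      ring
    have h2 : ∑ i, ∑ j, p i * p j * Real.exp (x j - x i) =
        ∑ i, ∑ j, p i * p j * Real.exp (x i - x j) := by
      rw [Finset.sum_comm]
      exact Finset.sum_congr rfl fun i _ => Finset.sum_congr rfl fun j _ => by ring
    have h3 : ∑ i, ∑ j, p i * p j * Real.cosh (x i - x j) ≤
        ∑ i, ∑ j, p i * p j * Real.exp (2 * b ^ 2) := by
      refine Finset.sum_le_sum fun i _ => Finset.sum_le_sum fun j _ =>
        mul_le_mul_of_nonneg_left ?_ (mul_nonneg (hp i) (hp j))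
      refine (Real.cosh_le_exp_half_sq _).trans (Real.exp_le_exp.2 ?_)
      have h4 : |x i - x j| ≤ 2 * b := (abs_sub _ _).trans (by linarith [hx i, hx j])
      have h5 := sq_le_sq' (by linarith [neg_abs_le (x i - x j)])
        ((le_abs_self _).trans h4)
      linarith
    have h4 : ∑ i, ∑ j, p i * p j * Real.exp (2 * b ^ 2) = Real.exp (2 * b ^ 2) := by
      simp only [← Finset.sum_mul, ← Finset.mul_sum, hp1, mul_one, one_mul]
    have h5 : ∑ i, ∑ j, p i * p j * Real.cosh (x i - x j) =
        1 / 2 * ∑ i, ∑ j, p i * p j * Real.exp (x i - x j) +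
          1 / 2 * ∑ i, ∑ j, p i * p j * Real.exp (x j - x i) := by
      simp only [Finset.mul_sum, ← Finset.sum_add_distrib]
      refine Finset.sum_congr rfl fun i _ => Finset.sum_congr rfl fun j _ => ?_
      rw [Real.cosh_eq, neg_sub]
      ring
    linarith
  have h0 : 0 ≤ ∑ k, p k * Real.exp (-x k) :=
    Finset.sum_nonneg fun k _ => mul_nonneg (hp k) (Real.exp_pos _).le
  have h := (mul_le_mul_of_nonneg_left hjensen h0).trans hprod
  rw [← le_div_iff₀ (Real.exp_pos _), ← Real.exp_sub] at h
  exact h.trans_eq (by ring_nf)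

/-- The exponential mean `(1/|κ|) ∑ₖ exp(-γ Λₖ)`. -/
def expMean {κ : Type*} [Fintype κ] (γ : ℝ) (Λ : κ → ℝ) : ℝ :=
  ∑ k, 1 / (Fintype.card κ : ℝ) * Real.exp (-γ * Λ k)

section Hedge

variable {κ : Type*} [Fintype κ] [Nonempty κ]

theorem expMean_pos (γ : ℝ) (Λ : κ → ℝ) : 0 < expMean γ Λ := by
  have : (0 : ℝ) < Fintype.card κ := by exact_mod_cast Fintype.card_pos (α := κ)
  exact Finset.sum_pos (fun k _ => by positivity) Finset.univ_nonempty

theorem sum_one_div_card : ∑ _k : κ, 1 / (Fintype.card κ : ℝ) = 1 := by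
  simp

/-- The normalized log-mean-exp is monotone in the rate. -/
theorem log_expMean_div_mono {γ γ' : ℝ} (h' : 0 < γ') (h : γ' ≤ γ) (Λ : κ → ℝ) :
    Real.log (expMean γ' Λ) / γ' ≤ Real.log (expMean γ Λ) / γ := by
  -- The claim is the power mean inequality with this exponent. It relies on the weights
  -- $1/|\kappa|$ in `expMean` summing to one.
  have hr : 1 ≤ γ / γ' := (one_le_div h').2 h
  have h1 := Real.rpow_arith_mean_le_arith_mean_rpow Finset.univ
    (fun _ : κ => 1 / (Fintype.card κ : ℝ)) (fun k => Real.exp (-γ' * Λ k))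
    (fun _ _ => by positivity) sum_one_div_card (fun _ _ => (Real.exp_pos _).le) hr
  have h2 : ∑ k : κ, 1 / (Fintype.card κ : ℝ) * Real.exp (-γ' * Λ k) ^ (γ / γ') =
      expMean γ Λ := by
    refine Finset.sum_congr rfl fun k _ => ?_
    rw [← Real.exp_mul]
    congr 2
    field_simp
  rw [h2] at h1
  have h3 := Real.log_le_log (Real.rpow_pos_of_pos (expMean_pos γ' Λ) _) h1
  rw [Real.log_rpow (expMean_pos γ' Λ)] at h3
  rw [le_div_iff₀ (h'.trans_le h)]
  calc Real.log (expMean γ' Λ) / γ' * γ = γ / γ' * Real.log (expMean γ' Λ) := by ring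
    _ ≤ _ := h3

/-- One step of Hedge. -/
theorem hedge_step {γ b : ℝ} (hγ : 0 < γ) (Λ x : κ → ℝ) (hx : ∀ k, |x k| ≤ b) :
    ∑ k, Real.exp (-γ * Λ k) / (∑ m, Real.exp (-γ * Λ m)) * x k ≤
      Real.log (expMean γ Λ) / γ - Real.log (expMean γ (Λ + x)) / γ + 2 * γ * b ^ 2 := by
  set Z := ∑ m, Real.exp (-γ * Λ m) with hZ
  have hZ0 : 0 < Z := Finset.sum_pos (fun k _ => Real.exp_pos _) Finset.univ_nonempty
  have h1 := sum_mul_exp_neg_le (p := fun k => Real.exp (-γ * Λ k) / Z) (x := fun k => γ * x k)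
    (b := γ * b) (fun k => by positivity) (by rw [← Finset.sum_div, ← hZ, div_self hZ0.ne'])
    (fun k => by
      rw [abs_mul, abs_of_pos hγ]
      exact mul_le_mul_of_nonneg_left (hx k) hγ.le)
  have h2 : ∑ k, Real.exp (-γ * Λ k) / Z * Real.exp (-(γ * x k)) =
      expMean γ (Λ + x) / expMean γ Λ := by
    have hc : (Fintype.card κ : ℝ) ≠ 0 := by exact_mod_cast (Fintype.card_pos (α := κ)).ne'
    rw [expMean, expMean, ← Finset.mul_sum, ← Finset.mul_sum, ← hZ,
      mul_div_mul_left _ _ (one_div_ne_zero hc), Finset.sum_div]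
    refine Finset.sum_congr rfl fun k _ => ?_
    rw [div_mul_eq_mul_div, ← Real.exp_add, Pi.add_apply]
    ring_nf
  have h3 : ∑ k, Real.exp (-γ * Λ k) / Z * (γ * x k) =
      γ * ∑ k, Real.exp (-γ * Λ k) / Z * x k := by
    rw [Finset.mul_sum]
    exact Finset.sum_congr rfl fun k _ => by ring
  rw [h2, h3] at h1
  have hq := div_pos (expMean_pos γ (Λ + x)) (expMean_pos γ Λ)
  have h4 := (Real.log_le_log hq h1)
  rw [Real.log_exp, Real.log_div (expMean_pos _ _).ne' (expMean_pos _ _).ne'] at h4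
  rw [← sub_div]
  refine le_of_mul_le_mul_left ?_ hγ
  rw [mul_add, mul_div_cancel₀ _ hγ.ne']
  linarith

theorem neg_log_expMean_div_le {γ : ℝ} (hγ : 0 < γ) (Λ : κ → ℝ) (k : κ) :
    -(Real.log (expMean γ Λ) / γ) ≤ Λ k + Real.log (Fintype.card κ) / γ := by
  have hc : (0 : ℝ) < Fintype.card κ := by exact_mod_cast Fintype.card_pos (α := κ)
  have h1 : 1 / (Fintype.card κ : ℝ) * Real.exp (-γ * Λ k) ≤ expMean γ Λ :=
    Finset.single_le_sum (f := fun k => 1 / (Fintype.card κ : ℝ) * Real.exp (-γ * Λ k))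
      (fun _ _ => by positivity) (Finset.mem_univ k)
  have h2 := Real.log_le_log (by positivity) h1
  rw [Real.log_mul (by positivity) (Real.exp_pos _).ne', Real.log_exp, one_div,
    Real.log_inv] at h2
  refine le_of_mul_le_mul_left ?_ hγ
  rw [mul_add, mul_neg, mul_div_cancel₀ _ hγ.ne', mul_div_cancel₀ _ hγ.ne']
  linarith

end Hedge

/-! ### The regret of MT-FTRL. -/

section Clique

variable {ι : Type} [Fintype ι] {d : ℕ}

/-- An expert whose decision set contains the comparator, at the right variance level. -/
theorem exists_mem_feasible [Nonempty ι] {mode : TopExpert} {u : ι → Vec d}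
    (hu : ∀ i, u i ∈ decisionSet d) (hmode : mode = TopExpert.constrained → cliqueVar u ≤ 1) :
    ∃ k : Fin (Fintype.card ι), u ∈ feasible mode k ∧
      levelScale k ≤ 2 * (1 + ((Fintype.card ι : ℝ) - 1) * cliqueVar u) := by
  have hc : 0 < Fintype.card ι := Fintype.card_pos
  have hn := card_pos_real (ι := ι)
  have hσ := cliqueVar_nonneg u
  have hprod := mul_nonneg (sub_nonneg.2 hn) hσ
  by_cases h1 : cliqueVar u ≤ 1
  · by_cases h0 : cliqueVar u = 0
    -- At zero variance the ceiling used below would be 0, which is not a level, so the lowest level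
    -- $1/n$ is taken.
    · have hs : levelScale (⟨0, hc⟩ : Fin (Fintype.card ι)) ≤ 2 := by
        have : ((Fintype.card ι : ℝ) - 1) / Fintype.card ι ≤ 1 := by
          rw [div_le_one (by linarith)]
          linarith
        simp only [levelScale, level, CharP.cast_eq_zero, zero_add]
        rw [div_mul_eq_mul_div, one_mul]
        linarith
      exact ⟨⟨0, hc⟩, ⟨hu, Or.inl (h0 ▸ (level_pos _).le)⟩, by linarith⟩
    · have hpos : 0 < cliqueVar u := lt_of_le_of_ne hσ (Ne.symm h0)
      -- The least level above the variance overshoots it by at most $1/n$, which adds at most 1 to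
      -- `levelScale`.
      set m := ⌈(Fintype.card ι : ℝ) * cliqueVar u⌉₊ with hm
      have hm0 : 0 < m := Nat.ceil_pos.2 (by positivity)
      have hmn : m ≤ Fintype.card ι := Nat.ceil_le.2 (by nlinarith)
      have hle := Nat.le_ceil ((Fintype.card ι : ℝ) * cliqueVar u)
      have hlt := Nat.ceil_lt_add_one (by positivity : 0 ≤ (Fintype.card ι : ℝ) * cliqueVar u)
      rw [← hm] at hle hlt
      have hlev : level ι ⟨m - 1, by omega⟩ = (m : ℝ) / Fintype.card ι := by
        have : ((m - 1 : ℕ) : ℝ) + 1 = m := by exact_mod_cast Nat.succ_pred_eq_of_pos hm0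
        rw [level, this]
      refine ⟨⟨m - 1, by omega⟩, ⟨hu, Or.inl ?_⟩, ?_⟩
      · rw [hlev, le_div_iff₀ (by linarith)]
        linarith
      · rw [levelScale, hlev]
        have h2 : (m : ℝ) / Fintype.card ι ≤ cliqueVar u + 1 / Fintype.card ι := by
          rw [div_le_iff₀ (by linarith), add_mul, one_div_mul_cancel (by linarith)]
          linarith
        have h3 : 1 / (Fintype.card ι : ℝ) * ((Fintype.card ι : ℝ) - 1) ≤ 1 := by
          rw [one_div_mul_eq_div, div_le_one (by linarith)]
          linarith
        have h4 := mul_le_mul_of_nonneg_right h2 (sub_nonneg.2 hn)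
        linarith
  -- A variance above 1 is covered only by the unconstrained top expert, whose `levelScale` is
  -- $n\le1+(n-1)\sigma^2$.
  · push Not at h1
    have hmode' : mode = TopExpert.unconstrained := by
      cases mode with
      | constrained => exact absurd (hmode rfl) (not_le.2 h1)
      | unconstrained => rfl
    have hlev : level ι ⟨Fintype.card ι - 1, by omega⟩ = 1 := by
      have : ((Fintype.card ι - 1 : ℕ) : ℝ) + 1 = Fintype.card ι := by
        exact_mod_cast Nat.succ_pred_eq_of_pos hc
      rw [level, this, div_self (by linarith)]
    refine ⟨⟨Fintype.card ι - 1, by omega⟩, ⟨hu, Or.inr ⟨hmode', hlev⟩⟩, ?_⟩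
    rw [levelScale, hlev]
    nlinarith

variable [DecidableEq ι]

/-- The cumulative linear loss of MT-FTRL along a history. -/
def mtftrlLoss (mode : TopExpert) (β : ℕ → ℝ) : List (ι × Vec d) → ℝ
  | [] => 0
  | r :: h => mtftrlLoss mode β h + ⟪r.2, mtftrl mode β h r.1⟫_ℝ

theorem inner_mtftrl (mode : TopExpert) (β : ℕ → ℝ) (h : List (ι × Vec d)) (i : ι) (v : Vec d) :
    ⟪v, mtftrl mode β h i⟫_ℝ =
      ∑ k, hedgeWeight mode β k h / (∑ m, hedgeWeight mode β m h) *
        ⟪v, expert mode β k h i⟫_ℝ := by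
  simp only [mtftrl, Finset.sum_apply, Pi.smul_apply, inner_sum, inner_smul_right]

theorem abs_inner_expert_le (mode : TopExpert) (β : ℕ → ℝ) (k : Fin (Fintype.card ι))
    (h : List (ι × Vec d)) (i : ι) {v : Vec d} {W : ℝ} (hv : ‖v‖ ≤ W) :
    |⟪v, expert mode β k h i⟫_ℝ| ≤ W := by
  have h1 := mem_closedBall_zero_iff.1 ((expert_spec mode β k h).1.1 i)
  have h2 := abs_real_inner_le_norm v (expert mode β k h i)
  nlinarith [norm_nonneg v]

/-- Hedge with the normalized log-mean-exp as potential. `Nontrivial ι` makes the rate positive, as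
$\ln 1=0$. -/
theorem mtftrlLoss_le_log [Nontrivial ι] (mode : TopExpert) {β : ℕ → ℝ} {W : ℝ}
    (hW : 0 < W) (hβ : ∀ n, β n = W * √(1 + n)) :
    ∀ h : List (ι × Vec d), (∀ r ∈ h, ‖r.2‖ ≤ W) →
      mtftrlLoss mode β h ≤
        -(Real.log (expMean (√(Real.log (Fintype.card ι)) / β h.length)
          fun k => expertLoss mode β k h) / (√(Real.log (Fintype.card ι)) / β h.length)) +
        4 * √(Real.log (Fintype.card ι)) * W * √h.length
  | [], _ => by
    have : Nonempty (Fin (Fintype.card ι)) := ⟨⟨0, Fintype.card_pos⟩⟩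
    have h1 : ∀ γ : ℝ, expMean γ (fun _ : Fin (Fintype.card ι) => (0 : ℝ)) = 1 := fun γ => by
      simp [expMean]
    simp [mtftrlLoss, expertLoss, h1]
  | r :: h, hh => by
    have : Nonempty (Fin (Fintype.card ι)) := ⟨⟨0, Fintype.card_pos⟩⟩
    have ih := mtftrlLoss_le_log mode hW hβ h fun s hs => hh s (List.mem_cons_of_mem _ hs)
    have hg : ‖r.2‖ ≤ W := hh r List.mem_cons_self
    have hlog : 0 < √(Real.log (Fintype.card ι)) :=
      Real.sqrt_pos.2 (Real.log_pos (by exact_mod_cast Fintype.one_lt_card (α := ι)))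
    have hβ0 : ∀ n, 0 < β n := fun n => by
      rw [hβ]
      positivity
    have hβm : β h.length ≤ β (r :: h).length := by
      rw [hβ, hβ, List.length_cons]
      gcongr
      omega
    have hmono := log_expMean_div_mono (div_pos hlog (hβ0 (r :: h).length))
      (div_le_div_of_nonneg_left hlog.le (hβ0 _) hβm) fun k => expertLoss mode β k (r :: h)
    have hstep := hedge_step (div_pos hlog (hβ0 h.length)) (fun k => expertLoss mode β k h)
      (fun k => ⟪r.2, expert mode β k h r.1⟫_ℝ) fun k => abs_inner_expert_le mode β k h r.1 hg
    have herr : 2 * (√(Real.log (Fintype.card ι)) / β h.length) * W ^ 2 ≤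
        4 * √(Real.log (Fintype.card ι)) * W * (√(r :: h).length - √h.length) := by
      have e : 2 * (√(Real.log (Fintype.card ι)) / β h.length) * W ^ 2 =
          2 * √(Real.log (Fintype.card ι)) * W * (1 / √(1 + (h.length : ℝ))) := by
        rw [hβ]
        field_simp
      have h1 := mul_le_mul_of_nonneg_left (one_div_sqrt_le h.length)
        (by positivity : 0 ≤ 2 * √(Real.log (Fintype.card ι)) * W)
      rw [e, List.length_cons, Nat.cast_succ, add_comm (h.length : ℝ)]
      linarith
    have hin := inner_mtftrl mode β h r.1 r.2
    simp only [hedgeWeight] at hin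
    rw [← hin] at hstep
    have hadd : ((fun k => expertLoss mode β k h) + fun k => ⟪r.2, expert mode β k h r.1⟫_ℝ) =
        fun k => expertLoss mode β k (r :: h) := rfl
    rw [hadd] at hstep
    simp only [mtftrlLoss]
    linarith

/-- The regret of MT-FTRL against its experts. -/
theorem mtftrlLoss_le_expertLoss (mode : TopExpert) {β : ℕ → ℝ} {W : ℝ}
    (hW : 0 < W) (hβ : ∀ n, β n = W * √(1 + n)) (k : Fin (Fintype.card ι))
    {h : List (ι × Vec d)} (hh : ∀ r ∈ h, ‖r.2‖ ≤ W) :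
    mtftrlLoss mode β h ≤ expertLoss mode β k h +
      5 * √(Real.log (Fintype.card ι)) * W * √(1 + h.length) := by
  have hc : 0 < Fintype.card ι := k.pos
  rcases (Nat.succ_le_of_lt hc).eq_or_lt with h1 | h1
  -- With one agent the Hedge rate is zero, but there is only one expert and MT-FTRL coincides with
  -- it.
  · have : Unique (Fin (Fintype.card ι)) := ⟨⟨k⟩, fun a => by ext; omega⟩
    have heq : ∀ h : List (ι × Vec d), mtftrlLoss mode β h = expertLoss mode β k h := by
      intro h
      induction h with
      | nil => rfl
      | cons r h ih =>
        have hw : hedgeWeight mode β default h ≠ 0 := (Real.exp_pos _).ne'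
        rw [mtftrlLoss, expertLoss, ih, inner_mtftrl, Fintype.sum_unique, Fintype.sum_unique,
          div_self hw, one_mul, Subsingleton.elim default k]
    rw [heq]
    have : 0 ≤ 5 * √(Real.log (Fintype.card ι)) * W * √(1 + h.length) := by positivity
    linarith
  · have : Nontrivial ι := Fintype.one_lt_card_iff_nontrivial.1 h1
    have : Nonempty (Fin (Fintype.card ι)) := ⟨k⟩
    have hl0 : 0 < Real.log (Fintype.card ι) := Real.log_pos (by exact_mod_cast h1)
    have hlog := Real.sqrt_pos.2 hl0
    have hβ0 : 0 < β h.length := by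
      rw [hβ]
      positivity
    have h2 := mtftrlLoss_le_log mode hW hβ h hh
    have h3 := neg_log_expMean_div_le (div_pos hlog hβ0) (fun k => expertLoss mode β k h) k
    have h4 : Real.log (Fintype.card (Fin (Fintype.card ι))) /
        (√(Real.log (Fintype.card ι)) / β h.length) =
        √(Real.log (Fintype.card ι)) * W * √(1 + h.length) := by
      rw [Fintype.card_fin, hβ, div_div_eq_mul_div, div_eq_iff hlog.ne']
      have := Real.mul_self_sqrt hl0.le
      linear_combination (-W * √(1 + (h.length : ℝ))) * this
    have h5 : √(h.length : ℝ) ≤ √(1 + h.length) := Real.sqrt_le_sqrt (by linarith)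
    have h6 := mul_le_mul_of_nonneg_left h5
      (by positivity : 0 ≤ 4 * √(Real.log (Fintype.card ι)) * W)
    linarith

/-- The regret of MT-FTRL. -/
theorem mtftrlLoss_le [Nonempty ι] {mode : TopExpert} {β : ℕ → ℝ} {W : ℝ}
    (hW : 0 < W) (hβ : ∀ n, β n = W * √(1 + n)) {h : List (ι × Vec d)}
    (hh : ∀ r ∈ h, ‖r.2‖ ≤ W) {u : ι → Vec d} (hu : ∀ i, u i ∈ decisionSet d)
    (hmode : mode = TopExpert.constrained → cliqueVar u ≤ 1) :
    mtftrlLoss mode β h - linearLoss h u ≤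
      20 * (1 + Real.log (Fintype.card ι)) *
        (W * √(1 + ((Fintype.card ι : ℝ) - 1) * cliqueVar u) * √h.length) := by
  cases h with
  -- The empty history is separate because $\sqrt{1+T}\le\sqrt2\sqrt T$ needs $T\ge1$.
  | nil => simp [mtftrlLoss, linearLoss]
  | cons r h =>
    set T := (r :: h).length with hT
    have hn := card_pos_real (ι := ι)
    have hlog := Real.log_nonneg hn
    obtain ⟨k, hk, hρ⟩ := exists_mem_feasible hu hmode
    have h1 := mtftrlLoss_le_expertLoss mode hW hβ k hh
    have h2 := expertLoss_le mode hW hβ hh hk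
    rw [← hT] at h1 h2
    set L := Real.log (Fintype.card ι)
    set S := 1 + ((Fintype.card ι : ℝ) - 1) * cliqueVar u
    have hS : 1 ≤ S := by
      have := mul_nonneg (sub_nonneg.2 hn) (cliqueVar_nonneg u)
      linarith
    have hT1 : (1 : ℝ) ≤ T := by
      rw [hT, List.length_cons]
      push_cast
      linarith [(Nat.cast_nonneg h.length : (0 : ℝ) ≤ h.length)]
    have a1 : √(1 + (T : ℝ)) ≤ √2 * √T := by
      rw [← Real.sqrt_mul (by norm_num)]
      exact Real.sqrt_le_sqrt (by linarith)
    have a2 : √(levelScale k) ≤ √2 * √S := by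
      rw [← Real.sqrt_mul (by norm_num)]
      exact Real.sqrt_le_sqrt hρ
    have a3 : √L ≤ 1 + L := Real.sqrt_le_iff.2 ⟨by linarith, by nlinarith⟩
    have a4 : 1 ≤ √S := Real.one_le_sqrt.2 hS
    have a5 : √2 * √2 = 2 := Real.mul_self_sqrt (by norm_num)
    have a6 : 1 ≤ √2 := Real.one_le_sqrt.2 (by norm_num)
    have b1 : √L + √(levelScale k) ≤ (1 + L) * (2 * √2 * √S) := by
      have c1 : √L ≤ (1 + L) * (√2 * √S) :=
        a3.trans (le_mul_of_one_le_right (by linarith) (one_le_mul_of_one_le_of_one_le a6 a4))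
      have c2 : √(levelScale k) ≤ (1 + L) * (√2 * √S) :=
        a2.trans (le_mul_of_one_le_left (by positivity) (by linarith))
      linarith
    calc mtftrlLoss mode β (r :: h) - linearLoss (r :: h) u
        ≤ 5 * W * ((√L + √(levelScale k)) * √(1 + (T : ℝ))) := by linarith
      _ ≤ 5 * W * ((1 + L) * (2 * √2 * √S) * (√2 * √T)) := by gcongr
      _ = 10 * (√2 * √2) * (1 + L) * (W * √S * √T) := by ring
      _ = 20 * (1 + L) * (W * √S * √T) := by rw [a5]; ring

end Clique

/-! ### Linearization of the losses. -/

theorem regret_le_sum_inner {V : Type} {d : ℕ} {ℓ : ℕ → Vec d → ℝ} {act : ℕ → V} {x g : ℕ → Vec d} {T : ℕ}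
    {U : V → Vec d} (hU : ∀ i, U i ∈ decisionSet d)
    (h : ∀ t < T, IsSubgradient (ℓ t) (x t) (g t)) :
    regret ℓ act x T U ≤ ∑ t ∈ Finset.range T, ⟪g t, x t - U (act t)⟫_ℝ := by
  refine Finset.sum_le_sum fun t ht => ?_
  have h1 := h t (Finset.mem_range.1 ht) (U (act t)) (hU _)
  rw [← neg_sub, inner_neg_right] at h1
  linarith

/-! ### Decomposition of the network regret into local regrets. -/

section Network

variable {V : Type} [Fintype V] {d : ℕ} (G : SimpleGraph V)

theorem mem_nbhd_self (j : V) : j ∈ nbhd G j := by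
  simp [nbhd]

instance nonempty_nbhd (j : V) : Nonempty (nbhd G j) := ⟨⟨j, mem_nbhd_self G j⟩⟩

theorem card_nbhd_pos (j : V) : (0 : ℝ) < (nbhd G j).card := by
  exact_mod_cast Finset.card_pos.2 ⟨j, mem_nbhd_self G j⟩

theorem sum_uniformWeight (i : V) : ∑ j, uniformWeight G i j = 1 := by
  have := (card_nbhd_pos G i).ne'
  simp only [uniformWeight, Finset.sum_ite_mem, Finset.univ_inter, Finset.sum_const, nsmul_eq_mul]
  field_simp

theorem sum_nbhd_uniformWeight (i : V) : ∑ j ∈ nbhd G i, uniformWeight G i j = 1 :=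
  (Finset.sum_subset (Finset.subset_univ _) fun _ _ hj => if_neg hj).trans (sum_uniformWeight G i)

theorem uniformWeight_of_mem {i j : V} (h : i ∈ nbhd G j) :
    uniformWeight G i j = 1 / ((nbhd G i).card : ℝ) :=
  if_pos (mem_nbhd_symm h)

/-- The local variance is the variance of the restriction to the neighborhood. -/
theorem localVar_eq_cliqueVar (U : V → Vec d) (j : V) :
    localVar G U j = cliqueVar fun i : nbhd G j => U i := by
  have hpos := card_nbhd_pos G j
  have h : ∑ i ∈ nbhd G j, ∑ i' ∈ nbhd G j, ‖U i - U i'‖ ^ 2 =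
      2 * ((nbhd G j).card : ℝ) * ∑ i : nbhd G j,
        ‖U i - (1 / (Fintype.card (nbhd G j) : ℝ)) • ∑ i' : nbhd G j, U i'‖ ^ 2 := by
    rw [sum_norm_sub_mean_sq fun i : nbhd G j => U i, Fintype.card_coe,
      Finset.sum_coe_sort (nbhd G j) U, Finset.sum_coe_sort (nbhd G j) fun i => ‖U i‖ ^ 2]
    simp only [norm_sub_sq_real, Finset.sum_add_distrib, Finset.sum_sub_distrib, Finset.sum_const,
      ← Finset.mul_sum, ← inner_sum, ← sum_inner, real_inner_self_eq_norm_sq, nsmul_eq_mul]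
    field_simp
    ring
  rw [localVar, cliqueVar, h, Fintype.card_coe, ← mul_assoc]
  congr 1
  -- Only $2N_j$ is cancelled, so $N_j=1$ needs no separate case: both sides carry the same inverse
  -- of $N_j-1$.
  rw [one_div, mul_inv, one_div, mul_assoc, mul_comm _ (2 * ((nbhd G j).card : ℝ)), ← mul_assoc,
    inv_mul_cancel₀ (by positivity), one_mul]

theorem localVar_le_maxLocalVar (U : V → Vec d) (j : V) : localVar G U j ≤ maxLocalVar G U :=
  le_ciSup (Set.finite_range _).bddAbove j

section History

variable (w : V → V → ℝ) (act : ℕ → V) (g : ℕ → Vec d)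

theorem localHistory_succ_of_mem {j : V} {t : ℕ} (h : act t ∈ nbhd G j) :
    localHistory G w act g j (t + 1) =
      (⟨act t, h⟩, w (act t) j • g t) :: localHistory G w act g j t :=
  dif_pos h

theorem localHistory_succ_of_notMem {j : V} {t : ℕ} (h : act t ∉ nbhd G j) :
    localHistory G w act g j (t + 1) = localHistory G w act g j t :=
  dif_neg h

open Classical in
theorem length_localHistory (j : V) (t : ℕ) :
    ((localHistory G w act g j t).length : ℝ) =
      ∑ s ∈ Finset.range t, if j ∈ nbhd G (act s) then (1 : ℝ) else 0 := by
  induction t with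
  | zero => simp [localHistory]
  | succ t ih =>
    rw [Finset.sum_range_succ, ← ih]
    by_cases h : act t ∈ nbhd G j
    · rw [localHistory_succ_of_mem G w act g h, if_pos (mem_nbhd_symm h), List.length_cons,
        Nat.cast_succ]
    · rw [localHistory_succ_of_notMem G w act g h, if_neg (mt mem_nbhd_symm h), add_zero]

variable {w g} in
theorem norm_le_of_mem_localHistory {j : V} {W : ℝ} (hw : ∀ i ∈ nbhd G j, |w i j| ≤ W) :
    ∀ t : ℕ, (∀ s < t, ‖g s‖ ≤ 1) → ∀ r ∈ localHistory G w act g j t, ‖r.2‖ ≤ W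
  | 0, _ => by simp [localHistory]
  | t + 1, hg => by
    have ih := norm_le_of_mem_localHistory hw t fun s hs => hg s (hs.trans t.lt_succ_self)
    by_cases h : act t ∈ nbhd G j
    · rw [localHistory_succ_of_mem G w act g h]
      intro r hr
      rcases List.mem_cons.1 hr with rfl | hr
      · rw [norm_smul, Real.norm_eq_abs]
        exact (mul_le_of_le_one_right (abs_nonneg _) (hg t t.lt_succ_self)).trans (hw _ h)
      · exact ih r hr
    · rwa [localHistory_succ_of_notMem G w act g h]

end History

open Classical in
/-- The linearized network regret splits into the local regrets. -/
theorem sum_inner_mtcool_eq (mode : TopExpert) (act : ℕ → V) (g : ℕ → Vec d) (U : V → Vec d)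
    (T : ℕ) :
    ∑ t ∈ Finset.range T, ⟪g t, mtcool mode G (uniformWeight G) act g t - U (act t)⟫_ℝ =
      ∑ j, (mtftrlLoss mode (localBeta G (uniformWeight G) j)
          (localHistory G (uniformWeight G) act g j T) -
        linearLoss (localHistory G (uniformWeight G) act g j T) fun i => U i) := by
  set w := uniformWeight G with hw
  induction T with
  | zero => simp [localHistory, mtftrlLoss, linearLoss]
  | succ T ih =>
    set F : V → ℝ := fun j => if h : act T ∈ nbhd G j then
      w (act T) j * ⟪g T, mtftrl mode (localBeta G w j) (localHistory G w act g j T) ⟨act T, h⟩ -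
        U (act T)⟫_ℝ else 0 with hF
    have hstep : ⟪g T, mtcool mode G w act g T - U (act T)⟫_ℝ = ∑ j, F j := by
      have h1 : ∑ j, F j = ∑ j : nbhd G (act T), F j := by
        rw [Finset.sum_coe_sort (nbhd G (act T)) F]
        refine (Finset.sum_subset (Finset.subset_univ _) fun j _ hj => ?_).symm
        exact dif_neg (mt mem_nbhd_symm hj)
      -- The comparator row is distributed over the neighborhood with the same weights as the
      -- prediction.
      have h2 : U (act T) = ∑ j : nbhd G (act T), w (act T) j • U (act T) := by
        rw [← Finset.sum_smul, Finset.sum_coe_sort (nbhd G (act T)) (w (act T)),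
          hw, sum_nbhd_uniformWeight, one_smul]
      rw [h1, mtcool, coolPrediction]
      nth_rewrite 1 [h2]
      rw [← Finset.sum_sub_distrib, inner_sum]
      refine Finset.sum_congr rfl fun j _ => ?_
      rw [hF]
      simp only
      rw [dif_pos (mem_nbhd_symm j.2), ← smul_sub, inner_smul_right]
    rw [Finset.sum_range_succ, ih, hstep, ← Finset.sum_add_distrib]
    refine Finset.sum_congr rfl fun j _ => ?_
    by_cases h : act T ∈ nbhd G j
    · rw [hF, localHistory_succ_of_mem G w act g h, mtftrlLoss, linearLoss_cons]
      simp only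
      rw [dif_pos h, real_inner_smul_left, real_inner_smul_left, inner_sub_right]
      ring
    · rw [hF, localHistory_succ_of_notMem G w act g h]
      simp only
      rw [dif_neg h, add_zero]

/-- The regret of MT-CO2OL when adjacent agents have neighborhoods of the same size. -/
theorem regret_mtcool_le {mode : TopExpert} {act : ℕ → V} {ℓ : ℕ → Vec d → ℝ} {g : ℕ → Vec d}
    {T : ℕ} (hℓ : ∀ t < T, IsSubgradient (ℓ t) (mtcool mode G (uniformWeight G) act g t) (g t))
    (hg : ∀ t < T, ‖g t‖ ≤ 1) {U : V → Vec d} (hU : ∀ i, U i ∈ decisionSet d)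
    (hmode : mode = TopExpert.constrained → ∀ j, localVar G U j ≤ 1)
    (hG : ∀ j, ∀ i ∈ nbhd G j, (nbhd G i).card = (nbhd G j).card) :
    regret ℓ act (mtcool mode G (uniformWeight G) act g) T U ≤
      20 * (1 + Real.log (Fintype.card V)) *
        (√(∑ j, (1 + (((nbhd G j).card : ℝ) - 1) * maxLocalVar G U) / (nbhd G j).card) *
          √(T : ℝ)) := by
  classical
  set n : V → ℝ := fun j => (nbhd G j).card with hn
  have hn0 : ∀ j, 0 < n j := card_nbhd_pos G
  have hn1 : ∀ j, 1 ≤ n j := fun j =>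
    Nat.one_le_cast.2 (Finset.card_pos.2 ⟨j, mem_nbhd_self G j⟩)
  set w := uniformWeight G with hw'
  have hw : ∀ j, ∀ i ∈ nbhd G j, w i j = 1 / n j := fun j i hi => by
    rw [hw', uniformWeight_of_mem G hi, hG j i hi]
  have hβ : ∀ j m, localBeta G w j m = 1 / n j * √(1 + (m : ℝ)) := fun j m => by
    rw [localBeta, iSup_congr fun i : nbhd G j => hw j i i.2, ciSup_const]
  set τ : V → ℝ := fun j => ((localHistory G w act g j T).length : ℝ) with hτ
  -- Each round is counted once by every neighbor of the active agent; equal neighborhood sizes turn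
  -- $1/N_j$ into the weight $w_{i_sj}$, so it contributes exactly 1.
  have hτsum : ∑ j, τ j / n j = T := by
    simp only [hτ, length_localHistory, Finset.sum_div]
    rw [Finset.sum_comm]
    have : ∀ s ∈ Finset.range T,
        ∑ j, (if j ∈ nbhd G (act s) then (1 : ℝ) else 0) / n j = 1 := by
      intro s _
      refine Eq.trans ?_ (sum_uniformWeight G (act s))
      refine Finset.sum_congr rfl fun j _ => ?_
      by_cases h : j ∈ nbhd G (act s)
      · rw [if_pos h, uniformWeight_of_mem G (mem_nbhd_symm h), ← hG _ j h]
      · rw [if_neg h, uniformWeight, if_neg h, zero_div]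
    rw [Finset.sum_congr rfl this]
    simp
  set S : V → ℝ := fun j => 1 + (n j - 1) * maxLocalVar G U with hS
  have hvar : ∀ j, 0 ≤ localVar G U j := fun j => by
    rw [localVar_eq_cliqueVar]
    exact cliqueVar_nonneg _
  have hS0 : ∀ j, 0 ≤ S j := fun j => by
    have := mul_nonneg (sub_nonneg.2 (hn1 j)) ((hvar j).trans (localVar_le_maxLocalVar G U j))
    linarith
  have hlocal : ∀ j, mtftrlLoss mode (localBeta G w j) (localHistory G w act g j T) -
      linearLoss (localHistory G w act g j T) (fun i => U i) ≤
      20 * (1 + Real.log (Fintype.card V)) * (√(S j / n j) * √(τ j / n j)) := by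
    intro j
    have h1 := mtftrlLoss_le (mode := mode) (one_div_pos.2 (hn0 j)) (hβ j)
      (norm_le_of_mem_localHistory G act (w := w) (g := g) (fun i hi => by
        rw [hw j i hi, abs_of_pos (one_div_pos.2 (hn0 j))]) T hg)
      (u := fun i : nbhd G j => U i) (fun i => hU i)
      (fun hm => by
        rw [← localVar_eq_cliqueVar]
        exact hmode hm j)
    rw [← localVar_eq_cliqueVar, Fintype.card_coe] at h1
    refine h1.trans ?_
    have hlog : Real.log (n j) ≤ Real.log (Fintype.card V) :=
      Real.log_le_log (hn0 j) (Nat.cast_le.2 (Finset.card_le_univ _))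
    have hlog0 := Real.log_nonneg (hn1 j)
    have hSj : √(1 + (n j - 1) * localVar G U j) ≤ √(S j) := by
      have := mul_le_mul_of_nonneg_left (localVar_le_maxLocalVar G U j) (sub_nonneg.2 (hn1 j))
      exact Real.sqrt_le_sqrt (by linarith)
    -- The factor $W=1/N_j$ is shared equally between the two square roots, in preparation for
    -- Cauchy–Schwarz over $j$.
    have hprod : √(S j / n j) * √(τ j / n j) = 1 / n j * √(S j) * √(τ j) := by
      rw [Real.sqrt_div (hS0 j), Real.sqrt_div (Nat.cast_nonneg _), div_mul_div_comm,
        Real.mul_self_sqrt (hn0 j).le]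
      ring
    rw [hprod]
    have := (one_div_pos.2 (hn0 j)).le
    gcongr
  refine (regret_le_sum_inner hU hℓ).trans ?_
  rw [sum_inner_mtcool_eq]
  refine (Finset.sum_le_sum fun j _ => hlocal j).trans ?_
  rw [← Finset.mul_sum, ← hτsum]
  have hlogN : 0 ≤ Real.log (Fintype.card V) := Real.log_natCast_nonneg _
  exact mul_le_mul_of_nonneg_left (Real.sum_sqrt_mul_sqrt_le _
    (fun j => div_nonneg (hS0 j) (hn0 j).le)
    fun j => div_nonneg (Nat.cast_nonneg _) (hn0 j).le) (by positivity)

theorem card_nbhd_of_isRegular [DecidableRel G.Adj] {K : ℕ} (h : G.IsRegularOfDegree K) (j : V) :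
    (nbhd G j).card = K + 1 := by
  classical
  have : nbhd G j = insert j (G.neighborFinset j) := by
    ext i
    simp [nbhd]
  rw [this, Finset.card_insert_of_notMem (by simp), G.card_neighborFinset_eq_degree, h j]

variable {G} in
theorem nbhd_eq_fiber {χ : ℕ} {c : V → Fin χ} (h : ∀ i j, G.Adj i j ↔ i ≠ j ∧ c i = c j) (j : V) :
    nbhd G j = Finset.univ.filter fun i => c i = c j := by
  ext i
  simp only [nbhd, Finset.mem_filter, Finset.mem_univ, true_and, h]
  by_cases e : i = j
  · simp [e]
  · simp [e, Ne.symm e, eq_comm]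

-- Every clique contributes exactly 1: it has $N_j$ members, each of weight $1/N_j$. Surjectivity of
-- `c` excludes empty cliques.
variable {G} in
theorem sum_one_div_card_nbhd {χ : ℕ} {c : V → Fin χ} (hc : Function.Surjective c)
    (h : ∀ i j, G.Adj i j ↔ i ≠ j ∧ c i = c j) :
    ∑ j, 1 / ((nbhd G j).card : ℝ) = χ := by
  rw [← Finset.sum_fiberwise Finset.univ c]
  have : ∀ a : Fin χ, ∑ j with c j = a, 1 / ((nbhd G j).card : ℝ) = 1 := by
    intro a
    obtain ⟨i, rfl⟩ := hc a
    have h1 : ∀ j ∈ Finset.univ.filter (fun j => c j = c i),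
        1 / ((nbhd G j).card : ℝ) = 1 / ((nbhd G i).card : ℝ) := fun j hj => by
      rw [nbhd_eq_fiber h j, nbhd_eq_fiber h i, (Finset.mem_filter.1 hj).2]
    rw [Finset.sum_congr rfl h1, Finset.sum_const, ← nbhd_eq_fiber h i, nsmul_eq_mul,
      mul_one_div_cancel (card_nbhd_pos G i).ne']
  rw [Finset.sum_congr rfl fun a _ => this a]
  simp

end Network

end MTCool

end

/-! ### The bounds for regular graphs and for unions of cliques. -/

open MTCool in
theorem mainTheorem6 :
    ∃ (C : ℝ) (p : ℕ), ∀ (N d T : ℕ) (G : SimpleGraph (Fin N)) [DecidableRel G.Adj]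
      (mode : TopExpert) (act : ℕ → Fin N) (ℓ : ℕ → Vec d → ℝ) (g : ℕ → Vec d),
      (∀ t < T, ConvexOn ℝ (decisionSet d) (ℓ t)) →
      (∀ t < T, IsSubgradient (ℓ t) (mtcool mode G (uniformWeight G) act g t) (g t)) →
      (∀ t < T, ‖g t‖ ≤ 1) →
      ∀ U : Fin N → Vec d, (∀ i, U i ∈ decisionSet d) →
        (mode = TopExpert.constrained → ∀ j, localVar G U j ≤ 1) →
        (∀ K : ℕ, G.IsRegularOfDegree K →
          regret ℓ act (mtcool mode G (uniformWeight G) act g) T U ≤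
            C * (1 + Real.log N) ^ p *
              (√(1 + K * maxLocalVar G U) * √((N : ℝ) * T / (K + 1)))) ∧
        (∀ χ : ℕ, IsUnionOfCliques G χ →
          regret ℓ act (mtcool mode G (uniformWeight G) act g) T U ≤
            C * (1 + Real.log N) ^ p *
              (√(χ + maxLocalVar G U * ((N : ℝ) - χ)) * √(T : ℝ))) := by
  refine ⟨20, 1, fun N d T G _ mode act ℓ g _ hℓ hg U hU hmode => ⟨fun K hK => ?_, ?_⟩⟩
  · have hcard := card_nbhd_of_isRegular G hK
    have h := regret_mtcool_le G hℓ hg hU hmode fun j i _ => by rw [hcard, hcard]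
    refine h.trans_eq ?_
    simp only [hcard, Fintype.card_fin, pow_one, Finset.sum_const, Finset.card_univ, nsmul_eq_mul,
      Nat.cast_add, Nat.cast_one, add_sub_cancel_right]
    have hσ : 0 ≤ maxLocalVar G U := Real.iSup_nonneg fun j => by
      rw [localVar_eq_cliqueVar]
      exact cliqueVar_nonneg _
    rw [← Real.sqrt_mul (by positivity), ← Real.sqrt_mul (by positivity)]
    congr 2
    ring
  · rintro χ ⟨c, hc, hadj⟩
    have h := regret_mtcool_le G hℓ hg hU hmode fun j i hi => by
      rw [nbhd_eq_fiber hadj j, Finset.mem_filter] at hi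
      rw [nbhd_eq_fiber hadj i, nbhd_eq_fiber hadj j, hi.2]
    refine h.trans_eq ?_
    have hsum : ∑ j, (1 + (((nbhd G j).card : ℝ) - 1) * maxLocalVar G U) / (nbhd G j).card =
        χ + maxLocalVar G U * ((N : ℝ) - χ) := by
      -- Each summand is affine in $1/N_j$, and these reciprocals add up to $\chi$.
      have h1 : ∀ j, (1 + (((nbhd G j).card : ℝ) - 1) * maxLocalVar G U) / (nbhd G j).card =
          (1 - maxLocalVar G U) * (1 / ((nbhd G j).card : ℝ)) + maxLocalVar G U := fun j => by
        have := (card_nbhd_pos G j).ne'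
        field_simp
        ring
      rw [Finset.sum_congr rfl fun j _ => h1 j, Finset.sum_add_distrib, ← Finset.mul_sum,
        sum_one_div_card_nbhd hc hadj]
      simp
      ring
    rw [hsum, Fintype.card_fin, pow_one]
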